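/- For a nonempty metric space $(Z,d)$, the diametrical graph $G_{Z,d}$ has vertex set $Z$, and two distinct points $u,v$ are adjacent if and only if $d(u,v)=\operatorname{diam} Z$. A graph is complete multipartite if its vertex set can be partitioned into at least two nonempty parts such that no edge has both ends in the same part and any two vertices in different parts are adjacent; we say that $A$ is a part of a graph $G$ if $G$ is complete multipartite and $A$ is one of its parts. For a nonempty totally bounded ultrametric space $(X,d)$, the representing tree $T_X$ is the graph whose vertices are the sets $A\subseteq X$ for which there is a finite sequence $X=X_1,X_2,\dots,X_n=A$ ($n\ge 1$) of subsets of $X$ such that $X_{i+1}$ is a part of $G_{X_i,\,d|_{X_i\times X_i}}$ for $1\le i\le n-1$ (these vertices are exactly the open balls of $X$). Two vertices $A,B$ are adjacent in $T_X$ if and only if $A$ is a part of $G_{B,\,d|_{B\times B}}$ or $B$ is a part of $G_{A,\,d|_{A\times A}}$. The labeled representing tree $T_X(l_X)$ is $T_X$ together with the labeling $l_X(B)=\operatorname{diam} B$ of its vertices. An isomorphism of labeled trees $T_1(l_1)$ and $T_2(l_2)$ is a bijection $f\colon V(T_1)\to V(T_2)$ such that $\{u,v\}\in E(T_1)\Leftrightarrow\{f(u),f(v)\}\in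 E(T_2)$ for all $u,v\in V(T_1)$ and $l_2(f(v))=l_1(v)$ for all $v\in V(T_1)$. **Theorem.** Let $(X,d)$ and $(Y,\rho)$ be nonempty totally bounded ultrametric spaces. Then the completions $(\widetilde X,\widetilde d)$ and $(\widetilde Y,\widetilde\rho)$ are isometric if and only if the labeled representing trees $T_X(l_X)$ and $T_Y(l_Y)$ are isomorphic. -/

import Mathlib

namespace UltrametricTree

universe u

/-- `P` is a system of parts exhibiting `G` as a complete `k`-partite graph for some cardinal
`k ≥ 2`: `P` is a partition of the vertex set into at least two nonempty parts, no edge has both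
ends in the same part, and any two vertices in different parts are adjacent. -/
def IsMultipartition {V : Type u} (G : SimpleGraph V) (P : Set (Set V)) : Prop :=
  Setoid.IsPartition P ∧ P.Nontrivial ∧
    ∀ S ∈ P, ∀ T ∈ P, ∀ u ∈ S, ∀ v ∈ T, (G.Adj u v ↔ S ≠ T)

/-- The diametrical graph of a metric space: two distinct points are adjacent iff their distance
is the diameter of the space. (It has no edges if the space is unbounded: `Metric.diam` is then
`0`, and distinct points are at positive distance.) -/
def diametricalGraph (X : Type u) [MetricSpace X] : SimpleGraph X where
  Adj u v := dist u v = Metric.diam (Set.univ : Set X) ∧ u ≠ v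
  symm := ⟨fun u v h => ⟨by rw [dist_comm]; exact h.1, h.2.symm⟩⟩
  loopless := ⟨fun _ h => h.2 rfl⟩

/-- `A` is a part of the (complete multipartite) diametrical graph of the subspace `B`. -/
def IsPartOf {X : Type u} [MetricSpace X] (A B : Set X) : Prop :=
  ∃ P : Set (Set B), IsMultipartition (diametricalGraph B) P ∧
    ∃ S ∈ P, A = Subtype.val '' S

/-- The vertices of the representing tree: the sets `A ⊆ X` for which there is a finite sequence
`X = X₁, …, Xₙ = A` such that each `Xᵢ₊₁` is a part of the diametrical graph of `Xᵢ`. -/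
def vertices (X : Type u) [MetricSpace X] : Set (Set X) :=
  {A | Relation.ReflTransGen (fun B C : Set X => IsPartOf C B) Set.univ A}

/-- No set is a part of its own diametrical graph. -/
theorem not_isPartOf_self {X : Type u} [MetricSpace X] (A : Set X) : ¬ IsPartOf A A := by
  rintro ⟨P, ⟨⟨hne, hP⟩, hnt, -⟩, S, hS, hA⟩
  have hS' : S = Set.univ := by
    ext x
    refine ⟨fun _ => trivial, fun _ => ?_⟩
    have hx : (x : X) ∈ Subtype.val '' S := hA ▸ x.2
    obtain ⟨y, hy, hyx⟩ := hx
    rwa [← Subtype.ext hyx]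
  obtain ⟨T, hT, hTS⟩ := hnt.exists_ne S
  have hTne : T.Nonempty := Set.nonempty_iff_ne_empty.mpr (fun h => hne (h ▸ hT))
  obtain ⟨x, hx⟩ := hTne
  exact hTS ((hP x).unique ⟨hT, hx⟩ ⟨hS, hS' ▸ trivial⟩)

/-- The (free) representing tree `T_X`: two vertices are adjacent iff one of them is a part of
the diametrical graph of the other. -/
def reprTree (X : Type u) [MetricSpace X] : SimpleGraph (vertices X) where
  Adj A B := IsPartOf (A : Set X) (B : Set X) ∨ IsPartOf (B : Set X) (A : Set X)
  symm := ⟨fun _ _ h => h.symm⟩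
  loopless := ⟨fun A h => not_isPartOf_self (A : Set X) (h.elim id id)⟩

/-- The labeling of the representing tree by diameters. -/
noncomputable def label (X : Type u) [MetricSpace X] (A : vertices X) : ℝ :=
  Metric.diam (A : Set X)

/-- Isomorphism of vertex-labeled graphs: a graph isomorphism that preserves the labels. -/
def LabeledIso {V : Type*} {W : Type*} (G : SimpleGraph V) (l : V → ℝ)
    (H : SimpleGraph W) (m : W → ℝ) : Prop :=
  ∃ f : G ≃g H, ∀ v : V, m (f v) = l v

end UltrametricTree

/-!
In a totally bounded ultrametric space positive diameters are attained. Hence the parts of the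
diametrical graph of a set `B` of positive diameter are exactly the traces on `B` of the open balls
of radius `diam B` with centre in `B` (`isPartOf_iff`). In particular the vertices of the
representing tree are clopen.

*Completions determine trees.* If `i : X → Z` is an isometry with dense range, then `B ↦ i ⁻¹' B`
is an isomorphism of labeled trees from `T_Z` to `T_X` (`labeledIso_of_denseRange`): a clopen set is
recovered from its trace on a dense set, and its diameter is not changed. Applied to `X → Ỹ` and
`Y → Ỹ` this gives one implication, and applied to `X → X̃` and `Y → Ỹ` it reduces the other one to
compact spaces.

*Trees determine compact spaces.* Passing to a part strictly decreases the diameter, so a labeled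
isomorphism `f` preserves the direction of the edges although the tree carries no root. The vertices
containing a given point `z` form a chain, hence so do their images under `f`, and by compactness
these images have a common point `φ z` (`exists_forall_mem_apply`). Two distinct points `z`, `w` lie
in a common vertex of diameter exactly `dist z w` (`exists_mem_vertices_diam_eq_dist`), because in a
totally bounded ultrametric space only finitely many distances exceed a given positive number.
So `φ` does not increase distances, the map `ψ` built from `f.symm` does not either, and the two are
inverse to each other because vertices separate points.
-/

namespace UltrametricTree

open Set Metric Relation

/-! ### Distances in totally bounded ultrametric spaces -/

section Space

variable {X : Type*} [MetricSpace X] [IsUltrametricDist X]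

theorem finite_setOf_dist_ge (hX : TotallyBounded (univ : Set X)) {r : ℝ} (hr : 0 < r) :
    {d : ℝ | r ≤ d ∧ ∃ x y : X, dist x y = d}.Finite := by
  obtain ⟨t, ht, hcov⟩ := totallyBounded_iff.1 hX r hr
  refine ((ht.prod ht).image fun p => dist p.1 p.2).subset ?_
  rintro d ⟨hd, x, y, rfl⟩
  obtain ⟨a, ha, hxa⟩ := mem_iUnion₂.1 (hcov (mem_univ x))
  obtain ⟨b, hb, hyb⟩ := mem_iUnion₂.1 (hcov (mem_univ y))
  refine ⟨(a, b), ⟨ha, hb⟩, ?_⟩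
  rw [mem_ball] at hxa hyb
  -- Moving the endpoints by less than `r` does not change a distance that is at least `r`.
  have h1 := dist_triangle_max x a y
  have h2 := dist_triangle_max a b y
  have h3 := dist_triangle_max a x b
  have h4 := dist_triangle_max x y b
  rw [dist_comm b y] at h2
  rw [dist_comm a x] at h3
  simp only [le_max_iff] at h1 h2 h3 h4
  show dist a b = dist x y
  grind

omit [IsUltrametricDist X] in
theorem isBounded_of_totallyBounded_univ (hX : TotallyBounded (univ : Set X)) (B : Set X) :
    Bornology.IsBounded B :=
  hX.isBounded.subset (subset_univ B)

theorem exists_dist_eq_diam (hX : TotallyBounded (univ : Set X)) {B : Set X} (hB : 0 < diam B) :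
    ∃ b ∈ B, ∃ c ∈ B, dist b c = diam B := by
  set S : Set ℝ := {d | diam B / 2 ≤ d ∧ ∃ b ∈ B, ∃ c ∈ B, dist b c = d} with hS
  have hfin : S.Finite := (finite_setOf_dist_ge hX (half_pos hB)).subset <| by
    rintro d ⟨hd, b, -, c, -, h⟩
    exact ⟨hd, b, c, h⟩
  have hne : S.Nonempty := by
    by_contra hemp
    have : diam B ≤ diam B / 2 := diam_le_of_forall_dist_le (by positivity) fun x hx y hy => by
      by_contra! h
      exact hemp ⟨_, h.le, x, hx, y, hy, rfl⟩
    linarith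
  obtain ⟨m, ⟨hm, b, hb, c, hc, rfl⟩, hmax⟩ := exists_max_image S id hfin hne
  refine ⟨b, hb, c, hc, le_antisymm
    (dist_le_diam_of_mem (isBounded_of_totallyBounded_univ hX B) hb hc) ?_⟩
  refine diam_le_of_forall_dist_le dist_nonneg fun x hx y hy => ?_
  rcases le_total (diam B / 2) (dist x y) with h | h
  · exact hmax _ ⟨h, x, hx, y, hy, rfl⟩
  · exact h.trans hm

/-! ### Parts of diametrical graphs -/

/-- The parts of a diametrical graph of positive diameter are the traces of the open balls whose
radius is the diameter; the diametrical graph has no parts if the diameter vanishes. -/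
theorem isPartOf_iff (hX : TotallyBounded (univ : Set X)) {A B : Set X} :
    IsPartOf A B ↔ 0 < diam B ∧ ∃ a ∈ B, A = B ∩ ball a (diam B) := by
  have hbd := isBounded_of_totallyBounded_univ hX B
  have hdiam : diam (univ : Set B) = diam B := by
    rw [← (isometry_subtype_coe (s := B)).diam_range, Subtype.range_coe]
  have hle : ∀ x y : B, dist x y ≤ diam B := fun x y => dist_le_diam_of_mem hbd x.2 y.2
  constructor
  · rintro ⟨P, ⟨⟨hne, hP⟩, hnt, hadj⟩, S, hS, rfl⟩
    have hnonempty : ∀ T ∈ P, T.Nonempty := fun T hT =>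
      nonempty_iff_ne_empty.2 fun h => hne (h ▸ hT)
    obtain ⟨a, ha⟩ := hnonempty S hS
    obtain ⟨T, hT, hTS⟩ := hnt.exists_ne S
    obtain ⟨b, hb⟩ := hnonempty T hT
    have hab := (hadj T hT S hS b hb a ha).2 hTS
    have hpos : 0 < diam B := by
      rw [← hdiam, ← hab.1]
      exact dist_pos.2 hab.2
    refine ⟨hpos, a, a.2, ?_⟩
    ext x
    constructor
    · rintro ⟨x, hx, rfl⟩
      refine ⟨x.2, (hle x a).lt_of_ne fun h => ?_⟩
      refine (hadj S hS S hS x hx a ha).1 ⟨h.trans hdiam.symm, ?_⟩ rfl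
      rintro rfl
      rw [dist_self] at h
      exact hpos.ne h
    · rintro ⟨hxB, hx⟩
      obtain ⟨U, ⟨hU, hxU⟩, -⟩ := hP ⟨x, hxB⟩
      rcases eq_or_ne U S with rfl | hUS
      · exact ⟨⟨x, hxB⟩, hxU, rfl⟩
      · have h := ((hadj U hU S hS _ hxU a ha).2 hUS).1
        rw [hdiam] at h
        exact absurd h hx.ne
  · rintro ⟨hpos, a, ha, rfl⟩
    let s : Setoid B :=
      { r := fun x y => dist x y < diam B
        iseqv := ⟨fun x => by rwa [dist_self], fun h => by rwa [dist_comm],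
          fun {x y z} h1 h2 => (dist_triangle_max (x : X) y z).trans_lt (max_lt h1 h2)⟩ }
    have hs : ∀ x y : B, s x y ↔ dist x y < diam B := fun _ _ => Iff.rfl
    have hclass : ∀ S ∈ s.classes, ∀ u ∈ S, S = {x | s x u} := fun S hS u hu =>
      Setoid.eq_of_mem_classes hS hu (s.mem_classes u) (s.refl u)
    refine ⟨s.classes, ⟨s.isPartition_classes, ?_, ?_⟩, {x | s x ⟨a, ha⟩}, s.mem_classes _, ?_⟩
    · obtain ⟨b, hb, c, hc, hbc⟩ := exists_dist_eq_diam hX hpos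
      refine ⟨_, s.mem_classes ⟨b, hb⟩, _, s.mem_classes ⟨c, hc⟩, fun h => ?_⟩
      have : s ⟨b, hb⟩ ⟨c, hc⟩ := by
        have : (⟨b, hb⟩ : B) ∈ {x | s x ⟨b, hb⟩} := s.refl _
        rwa [h] at this
      exact ((hs _ _).1 this).ne hbc
    · intro S hS T hT u hu v hv
      have hST : S = T ↔ s u v := by
        constructor
        · rintro rfl
          rw [hclass S hS v hv] at hu
          exact hu
        · intro h
          refine Setoid.eq_of_mem_classes hS hu hT ?_
          rw [hclass T hT v hv]
          exact h
      rw [Ne, hST, hs, not_lt]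
      show dist u v = _ ∧ u ≠ v ↔ _
      rw [hdiam]
      refine ⟨fun h => h.1.ge, fun h => ⟨le_antisymm (hle u v) h, ?_⟩⟩
      rintro rfl
      rw [dist_self] at h
      exact hpos.not_ge h
    · ext x
      constructor
      · rintro ⟨hxB, hx⟩
        exact ⟨⟨x, hxB⟩, hx, rfl⟩
      · rintro ⟨x, hx, rfl⟩
        exact ⟨x.2, hx⟩

theorem IsPartOf.subset (hX : TotallyBounded (univ : Set X)) {A B : Set X} (h : IsPartOf A B) :
    A ⊆ B := by
  obtain ⟨-, a, -, rfl⟩ := (isPartOf_iff hX).1 h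
  exact inter_subset_left

theorem IsPartOf.diam_lt (hX : TotallyBounded (univ : Set X)) {A B : Set X} (h : IsPartOf A B) :
    diam A < diam B := by
  obtain ⟨hpos, a, -, rfl⟩ := (isPartOf_iff hX).1 h
  rcases (diam_nonneg (s := B ∩ ball a (diam B))).eq_or_lt with h0 | h0
  · rwa [← h0]
  · obtain ⟨b, hb, c, hc, hbc⟩ := exists_dist_eq_diam hX h0
    rw [← hbc]
    exact (dist_triangle_max b a c).trans_lt (max_lt hb.2 (mem_ball'.1 hc.2))

theorem isPartOf_inter_ball (hX : TotallyBounded (univ : Set X)) {B : Set X} (hB : 0 < diam B)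
    {x : X} (hx : x ∈ B) : IsPartOf (B ∩ ball x (diam B)) B :=
  (isPartOf_iff hX).2 ⟨hB, x, hx, rfl⟩

theorem IsPartOf.eq_inter_ball (hX : TotallyBounded (univ : Set X)) {A B : Set X}
    (h : IsPartOf A B) {x : X} (hx : x ∈ A) : A = B ∩ ball x (diam B) := by
  obtain ⟨-, a, -, rfl⟩ := (isPartOf_iff hX).1 h
  rw [IsUltrametricDist.ball_eq_of_mem hx.2]

theorem IsPartOf.nonempty (hX : TotallyBounded (univ : Set X)) {A B : Set X} (h : IsPartOf A B) :
    A.Nonempty := by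
  obtain ⟨hpos, a, ha, rfl⟩ := (isPartOf_iff hX).1 h
  exact ⟨a, ha, mem_ball_self hpos⟩

/-! ### Vertices of the representing tree -/

omit [IsUltrametricDist X] in
theorem univ_mem_vertices : (univ : Set X) ∈ vertices X :=
  ReflTransGen.refl

omit [IsUltrametricDist X] in
theorem IsPartOf.mem_vertices {A B : Set X} (h : IsPartOf A B) (hB : B ∈ vertices X) :
    A ∈ vertices X :=
  ReflTransGen.tail hB h

theorem isClopen_of_mem_vertices (hX : TotallyBounded (univ : Set X)) {B : Set X}
    (hB : B ∈ vertices X) : IsClopen B := by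
  induction hB with
  | refl => exact isClopen_univ
  | tail _ h ih =>
    obtain ⟨-, a, -, rfl⟩ := (isPartOf_iff hX).1 h
    exact ih.inter (IsUltrametricDist.isClopen_ball a _)

theorem nonempty_of_mem_vertices [Nonempty X] (hX : TotallyBounded (univ : Set X)) {B : Set X}
    (hB : B ∈ vertices X) : B.Nonempty := by
  rcases ReflTransGen.cases_tail hB with rfl | ⟨C, -, h⟩
  · exact univ_nonempty
  · exact h.nonempty hX

/-- Vertices with a common point are comparable. -/
theorem reflTransGen_or_of_mem (hX : TotallyBounded (univ : Set X)) {B C : Set X}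
    (hB : B ∈ vertices X) (hC : C ∈ vertices X) {x : X} (hxB : x ∈ B) (hxC : x ∈ C) :
    ReflTransGen (fun S T => IsPartOf T S) B C ∨ ReflTransGen (fun S T => IsPartOf T S) C B := by
  -- A set has at most one part containing `x`, so the descent towards `x` is deterministic.
  let R : Set X → Set X → Prop := fun S T => IsPartOf T S ∧ x ∈ T
  have hle : R ≤ fun S T => IsPartOf T S := fun _ _ h => h.1
  have huniq : Relator.RightUnique R := fun S T T' h h' =>
    (h.1.eq_inter_ball hX h.2).trans (h'.1.eq_inter_ball hX h'.2).symm
  have key : ∀ {S : Set X}, S ∈ vertices X → x ∈ S → ReflTransGen R univ S := by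
    intro S hS hx
    induction hS with
    | refl => exact .refl
    | tail _ h ih => exact (ih (h.subset hX hx)).tail ⟨h, hx⟩
  exact (ReflTransGen.total_of_right_unique huniq (key hB hxB) (key hC hxC)).imp
    (ReflTransGen.mono hle _ _) (ReflTransGen.mono hle _ _)

/-- Among the vertices containing both points, one of least diameter has diameter `dist x y`:
otherwise both points would lie in the same part of it. -/
theorem exists_mem_vertices_diam_eq_dist (hX : TotallyBounded (univ : Set X)) {x y : X}
    (hxy : x ≠ y) : ∃ B ∈ vertices X, x ∈ B ∧ y ∈ B ∧ diam B = dist x y := by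
  have hpos : 0 < dist x y := dist_pos.2 hxy
  let S : Set (Set X) := {B | B ∈ vertices X ∧ x ∈ B ∧ y ∈ B}
  have hge : ∀ B ∈ S, dist x y ≤ diam B := fun B hB =>
    dist_le_diam_of_mem (isBounded_of_totallyBounded_univ hX B) hB.2.1 hB.2.2
  -- The diameters of these vertices are distances, hence take finitely many values.
  have hfin : (diam '' S).Finite := (finite_setOf_dist_ge hX hpos).subset <| by
    rintro _ ⟨B, hB, rfl⟩
    obtain ⟨b, -, c, -, h⟩ := exists_dist_eq_diam hX (hpos.trans_le (hge B hB))
    exact ⟨hge B hB, b, c, h⟩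
  obtain ⟨_, ⟨B, hB, rfl⟩, hmin⟩ := exists_min_image (diam '' S) id hfin
    ⟨_, mem_image_of_mem _ ⟨univ_mem_vertices, mem_univ x, mem_univ y⟩⟩
  refine ⟨B, hB.1, hB.2.1, hB.2.2, (hge B hB).antisymm' (not_lt.1 fun hlt => ?_)⟩
  have hpart := isPartOf_inter_ball hX (hpos.trans hlt) hB.2.1
  exact (hpart.diam_lt hX).not_ge <| hmin _ <| mem_image_of_mem _
    ⟨hpart.mem_vertices hB.1, ⟨hB.2.1, mem_ball_self (hpos.trans hlt)⟩, hB.2.2, mem_ball'.2 hlt⟩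

theorem exists_mem_vertices_notMem (hX : TotallyBounded (univ : Set X)) {x y : X} (hxy : x ≠ y) :
    ∃ B ∈ vertices X, x ∈ B ∧ y ∉ B := by
  obtain ⟨B, hB, hx, -, hd⟩ := exists_mem_vertices_diam_eq_dist hX hxy
  have hpos : 0 < diam B := hd ▸ dist_pos.2 hxy
  refine ⟨_, (isPartOf_inter_ball hX hpos hx).mem_vertices hB, ⟨hx, mem_ball_self hpos⟩,
    fun h => ?_⟩
  exact (mem_ball'.1 h.2).ne hd.symm

end Space

/-! ### Labeled isomorphisms -/

theorem LabeledIso.symm {V W : Type*} {G : SimpleGraph V} {l : V → ℝ} {H : SimpleGraph W}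
    {m : W → ℝ} : LabeledIso G l H m → LabeledIso H m G l := by
  rintro ⟨f, hf⟩
  exact ⟨f.symm, fun w => by rw [← hf, RelIso.apply_symm_apply]⟩

theorem LabeledIso.trans {U V W : Type*} {F : SimpleGraph U} {k : U → ℝ} {G : SimpleGraph V}
    {l : V → ℝ} {H : SimpleGraph W} {m : W → ℝ} :
    LabeledIso F k G l → LabeledIso G l H m → LabeledIso F k H m := by
  rintro ⟨f, hf⟩ ⟨g, hg⟩
  exact ⟨f.trans g, fun u => (hg (f u)).trans (hf u)⟩

/-! ### Dense isometric embeddings -/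

section Dense

variable {X Z : Type*} [MetricSpace X] [MetricSpace Z] [IsUltrametricDist X] [IsUltrametricDist Z]

omit [IsUltrametricDist X] [IsUltrametricDist Z] in
theorem diam_preimage_of_denseRange {i : X → Z} (hi : Isometry i) (hd : DenseRange i) {B : Set Z}
    (hB : IsOpen B) (hbd : Bornology.IsBounded B) : diam (i ⁻¹' B) = diam B := by
  rw [← hi.diam_image, image_preimage_eq_inter_range]
  refine (diam_mono inter_subset_left hbd).antisymm ?_
  rw [← diam_closure (s := B ∩ range i)]
  exact diam_mono (hd.open_subset_closure_inter hB) (hbd.subset inter_subset_left).closure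

variable (hX : TotallyBounded (univ : Set X)) (hZ : TotallyBounded (univ : Set Z))
  {i : X → Z} (hi : Isometry i) (hd : DenseRange i)

include hX hZ hi hd

theorem IsPartOf.preimage {A B : Set Z} (hB : B ∈ vertices Z) (h : IsPartOf A B) :
    IsPartOf (i ⁻¹' A) (i ⁻¹' B) := by
  have hdiam := diam_preimage_of_denseRange hi hd (isClopen_of_mem_vertices hZ hB).isOpen
    (isBounded_of_totallyBounded_univ hZ B)
  obtain ⟨x, hx⟩ := hd.exists_mem_open
    (isClopen_of_mem_vertices hZ (h.mem_vertices hB)).isOpen (h.nonempty hZ)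
  refine (isPartOf_iff hX).2 ⟨?_, x, h.subset hZ hx, ?_⟩
  · rw [hdiam]
    exact ((isPartOf_iff hZ).1 h).1
  · rw [h.eq_inter_ball hZ hx, preimage_inter, hi.preimage_ball, hdiam]

theorem exists_isPartOf_of_isPartOf_preimage {A : Set X} {B : Set Z} (hB : B ∈ vertices Z)
    (h : IsPartOf A (i ⁻¹' B)) : ∃ C, IsPartOf C B ∧ i ⁻¹' C = A := by
  have hdiam := diam_preimage_of_denseRange hi hd (isClopen_of_mem_vertices hZ hB).isOpen
    (isBounded_of_totallyBounded_univ hZ B)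
  obtain ⟨hpos, x, hx, rfl⟩ := (isPartOf_iff hX).1 h
  refine ⟨_, isPartOf_inter_ball hZ (hdiam ▸ hpos) hx, ?_⟩
  rw [preimage_inter, hi.preimage_ball, hdiam]

omit [MetricSpace X] [IsUltrametricDist X] hX hi in
theorem preimage_injOn_vertices : InjOn (i ⁻¹' ·) (vertices Z) := by
  have key : ∀ {B : Set Z}, B ∈ vertices Z → closure (i '' (i ⁻¹' B)) = B := fun hB => by
    have hcl := isClopen_of_mem_vertices hZ hB
    rw [image_preimage_eq_inter_range]
    exact (closure_minimal inter_subset_left hcl.isClosed).antisymm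
      (hd.open_subset_closure_inter hcl.isOpen)
  intro B hB C hC h
  rw [← key hB, ← key hC]
  exact congrArg (fun S => closure (i '' S)) h

theorem bijOn_preimage_vertices : BijOn (i ⁻¹' ·) (vertices Z) (vertices X) := by
  refine ⟨fun B hB => ?_, preimage_injOn_vertices hZ hd, fun A hA => ?_⟩
  · induction hB with
    | refl => exact univ_mem_vertices
    | tail hB h ih => exact (h.preimage hX hZ hi hd hB).mem_vertices ih
  · induction hA with
    | refl => exact ⟨univ, univ_mem_vertices, rfl⟩
    | tail _ h ih =>
      obtain ⟨B, hB, rfl⟩ := ih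
      obtain ⟨C, hC, rfl⟩ := exists_isPartOf_of_isPartOf_preimage hX hZ hi hd hB h
      exact ⟨C, hC.mem_vertices hB, rfl⟩

theorem isPartOf_preimage_iff {A B : Set Z} (hA : A ∈ vertices Z) (hB : B ∈ vertices Z) :
    IsPartOf (i ⁻¹' A) (i ⁻¹' B) ↔ IsPartOf A B := by
  refine ⟨fun h => ?_, fun h => h.preimage hX hZ hi hd hB⟩
  obtain ⟨C, hC, hCA⟩ := exists_isPartOf_of_isPartOf_preimage hX hZ hi hd hB h
  rwa [← preimage_injOn_vertices hZ hd (hC.mem_vertices hB) hA hCA]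

theorem labeledIso_of_denseRange :
    LabeledIso (reprTree X) (label X) (reprTree Z) (label Z) := by
  refine LabeledIso.symm
    ⟨⟨(bijOn_preimage_vertices hX hZ hi hd).equiv, fun {A B} => ?_⟩, fun B => ?_⟩
  · exact or_congr (isPartOf_preimage_iff hX hZ hi hd A.2 B.2)
      (isPartOf_preimage_iff hX hZ hi hd B.2 A.2)
  · exact diam_preimage_of_denseRange hi hd (isClopen_of_mem_vertices hZ B.2).isOpen
      (isBounded_of_totallyBounded_univ hZ _)

end Dense

/-! ### Recovering a compact space from its labeled tree -/

section Compact

variable {X Y : Type*} [MetricSpace X] [MetricSpace Y] [IsUltrametricDist X] [IsUltrametricDist Y]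
  (hX : TotallyBounded (univ : Set X)) (hY : TotallyBounded (univ : Set Y))
  (f : reprTree X ≃g reprTree Y) (hf : ∀ A, label Y (f A) = label X A)

include hX hY hf

/-- The labels orient the edges of the tree, so a labeled isomorphism preserves the relation
between a vertex and its parts. -/
theorem isPartOf_apply {A B : vertices X} (h : IsPartOf (A : Set X) B) :
    IsPartOf (f A : Set Y) (f B) := by
  have hlt : label Y (f A) < label Y (f B) := by
    rw [hf, hf]
    exact h.diam_lt hX
  refine (f.map_adj_iff.2 (Or.inl h : (reprTree X).Adj A B)).resolve_right fun h' => ?_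
  exact (h'.diam_lt hY).not_gt hlt

theorem apply_subset_of_reflTransGen {B : vertices X} {C : Set X} (hC : C ∈ vertices X)
    (h : ReflTransGen (fun S T : Set X => IsPartOf T S) B C) :
    (f ⟨C, hC⟩ : Set Y) ⊆ f B := by
  induction h with
  | refl => exact Subset.rfl
  | tail h' h ih =>
    have hD := ReflTransGen.trans B.2 h'
    exact ((isPartOf_apply hX hY f hf (A := ⟨_, hC⟩) (B := ⟨_, hD⟩) h).subset hY).trans (ih hD)

theorem exists_forall_mem_apply [CompactSpace Y] [Nonempty Y] (x : X) :
    ∃ y : Y, ∀ B : vertices X, x ∈ (B : Set X) → y ∈ (f B : Set Y) := by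
  have : Nonempty {B : vertices X // x ∈ (B : Set X)} :=
    ⟨⟨⟨univ, univ_mem_vertices⟩, mem_univ x⟩⟩
  have hcl : ∀ B : vertices X, IsClosed (f B : Set Y) := fun B =>
    (isClopen_of_mem_vertices hY (f B).2).isClosed
  obtain ⟨y, hy⟩ := IsCompact.nonempty_iInter_of_directed_nonempty_isCompact_isClosed
    (fun B : {B : vertices X // x ∈ (B : Set X)} => (f B.1 : Set Y))
    (fun B C => by
      rcases reflTransGen_or_of_mem hX B.1.2 C.1.2 B.2 C.2 with h | h
      · exact ⟨C, apply_subset_of_reflTransGen hX hY f hf _ h, Subset.rfl⟩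
      · exact ⟨B, Subset.rfl, apply_subset_of_reflTransGen hX hY f hf _ h⟩)
    (fun B => nonempty_of_mem_vertices hY (f B.1).2) (fun B => (hcl B.1).isCompact)
    (fun B => hcl B.1)
  exact ⟨y, fun B hB => mem_iInter.1 hy ⟨B, hB⟩⟩

omit [IsUltrametricDist Y] in
theorem dist_le_of_forall_mem_apply {φ : X → Y}
    (hφ : ∀ x, ∀ B : vertices X, x ∈ (B : Set X) → φ x ∈ (f B : Set Y)) (x y : X) :
    dist (φ x) (φ y) ≤ dist x y := by
  rcases eq_or_ne x y with rfl | hxy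
  · rw [dist_self, dist_self]
  · obtain ⟨B, hB, hx, hy, hd⟩ := exists_mem_vertices_diam_eq_dist hX hxy
    rw [← hd]
    calc dist (φ x) (φ y) ≤ label Y (f ⟨B, hB⟩) :=
          dist_le_diam_of_mem (hY.isBounded.subset (subset_univ _)) (hφ x _ hx) (hφ y _ hy)
      _ = diam B := hf _

omit hY hf [IsUltrametricDist Y] in
theorem leftInverse_of_forall_mem_apply {φ : X → Y} {ψ : Y → X}
    (hφ : ∀ x, ∀ B : vertices X, x ∈ (B : Set X) → φ x ∈ (f B : Set Y))
    (hψ : ∀ y, ∀ B : vertices Y, y ∈ (B : Set Y) → ψ y ∈ (f.symm B : Set X)) :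
    Function.LeftInverse ψ φ := by
  intro x
  by_contra hne
  obtain ⟨B, hB, hx, hnot⟩ := exists_mem_vertices_notMem hX (Ne.symm hne)
  have h := hψ _ _ (hφ x ⟨B, hB⟩ hx)
  rw [RelIso.symm_apply_apply] at h
  exact hnot h

omit hX hY hf in
theorem nonempty_isometryEquiv_of_labeledIso [CompactSpace X] [CompactSpace Y] [Nonempty X]
    [Nonempty Y] (h : LabeledIso (reprTree X) (label X) (reprTree Y) (label Y)) :
    Nonempty (X ≃ᵢ Y) := by
  obtain ⟨f, hf⟩ := h
  have hX : TotallyBounded (univ : Set X) := isCompact_univ.totallyBounded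
  have hY : TotallyBounded (univ : Set Y) := isCompact_univ.totallyBounded
  have hf' : ∀ B, label X (f.symm B) = label Y B := fun B => by
    rw [← hf, RelIso.apply_symm_apply]
  choose φ hφ using exists_forall_mem_apply hX hY f hf
  choose ψ hψ using exists_forall_mem_apply hY hX f.symm hf'
  have hl : Function.LeftInverse ψ φ := leftInverse_of_forall_mem_apply hX f hφ hψ
  have hr : Function.LeftInverse φ ψ := leftInverse_of_forall_mem_apply hY f.symm hψ hφ
  refine ⟨⟨⟨φ, ψ, hl, hr⟩, Isometry.of_dist_eq fun x y => ?_⟩⟩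
  refine (dist_le_of_forall_mem_apply hX hY f hf hφ x y).antisymm ?_
  have := dist_le_of_forall_mem_apply hY hX f.symm hf' hψ (φ x) (φ y)
  rwa [hl, hl] at this

end Compact

/-! ### Completions -/

section Completion

open UniformSpace

variable {X : Type*} [MetricSpace X]

instance isUltrametricDist_completion [IsUltrametricDist X] :
    IsUltrametricDist (Completion X) where
  dist_triangle_max x y z := by
    refine Completion.induction_on₃ x y z (isClosed_le (by fun_prop) (by fun_prop))
      fun a b c => ?_
    simpa only [Completion.dist_eq] using dist_triangle_max a b c

theorem compactSpace_completion (hX : TotallyBounded (univ : Set X)) :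
    CompactSpace (Completion X) := by
  have h := (hX.image (Completion.uniformContinuous_coe X)).closure
  rw [image_univ, Completion.denseRange_coe.closure_range] at h
  exact ⟨h.isCompact_of_isClosed isClosed_univ⟩

end Completion

end UltrametricTree

open UltrametricTree in
theorem theoremt11p12 {X : Type*} {Y : Type*} [MetricSpace X] [MetricSpace Y]
    [IsUltrametricDist X] [IsUltrametricDist Y] [Nonempty X] [Nonempty Y]
    (hX : TotallyBounded (Set.univ : Set X)) (hY : TotallyBounded (Set.univ : Set Y)) :
    Nonempty (UniformSpace.Completion X ≃ᵢ UniformSpace.Completion Y) ↔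
      UltrametricTree.LabeledIso
        (UltrametricTree.reprTree X) (UltrametricTree.label X)
        (UltrametricTree.reprTree Y) (UltrametricTree.label Y) := by
  have := compactSpace_completion hX
  have := compactSpace_completion hY
  have : Nonempty (UniformSpace.Completion X) := .map (↑) ‹Nonempty X›
  have : Nonempty (UniformSpace.Completion Y) := .map (↑) ‹Nonempty Y›
  have hX' : TotallyBounded (Set.univ : Set (UniformSpace.Completion X)) :=
    isCompact_univ.totallyBounded
  have hY' : TotallyBounded (Set.univ : Set (UniformSpace.Completion Y)) :=
    isCompact_univ.totallyBounded
  have isoX := labeledIso_of_denseRange hX hX' UniformSpace.Completion.coe_isometry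
    UniformSpace.Completion.denseRange_coe
  have isoY := labeledIso_of_denseRange hY hY' UniformSpace.Completion.coe_isometry
    UniformSpace.Completion.denseRange_coe
  constructor
  · rintro ⟨e⟩
    exact (labeledIso_of_denseRange hX hY' (e.isometry.comp UniformSpace.Completion.coe_isometry)
      (e.surjective.denseRange.comp UniformSpace.Completion.denseRange_coe e.continuous)).trans
        isoY.symm
  · intro h
    exact nonempty_isometryEquiv_of_labeledIso (isoX.symm.trans (h.trans isoY))
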